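/- Let $q$ be a prime power, $\mathbb F$ a field with $q^2$ elements, and $R=\mathbb F[X,Y]/\langle Y^q+Y-X^{q+1}\rangle=\mathbb F[x,y]$ the coordinate ring of the affine Hermitian curve $H$. Let $P_1,\dots,P_n$ be all the rational points of $H$, let $P_\infty$ be the unique point at infinity of the projective closure of $H$, and let $v_{P_\infty}$ be the valuation of the function field $K(H)$ at $P_\infty$. Let $M=[m_{i\gamma}\mid 1\le i\le n,\ \gamma\in\mathbb F]$ be a family of nonnegative integers. For $1\le i\le n$ and $\gamma\in\mathbb F$ let $\mathfrak m_{(P_i,\gamma)}\subset R[z]$ be the maximal ideal of all $f$ with $f(P_i,\gamma)=0$, let $\operatorname{mult}_{(P_i,\gamma)}(f)$ be the largest $r$ with $f\in\mathfrak m_{(P_i,\gamma)}^r$ (and $\infty$ for $f=0$), and let \[ I_M=\{f\in R[z]\mid \operatorname{mult}_{(P_i,\gamma)}(f)\ge m_{i\gamma}\text{ for all } i,\gamma\}. \] Let $\Omega=\{x^iy^jz^k\mid i,k\ge 0,\ 0\le j\le q-1\}$ be the set of monomials of $R[z]$; it is a basis of $R[z]$ over $\mathbb F$. (1) If $A\subset\Omega$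 is finite and $|A|>\sum_{i=1}^n\sum_{\gamma\in\mathbb F}\binom{m_{i\gamma}+1}{2}$, then there are coefficients $c_\phi\in\mathbb F$ $(\phi\in A)$ such that $0\ne\sum_{\phi\in A}c_\phi\phi\in I_M$. Now fix a positive integer $u$. For a nonzero $f=\sum_k\psi_kz^k\in R[z]$ with $\psi_k\in R$, let $\deg_u(f)=\max_{\psi_k\ne 0}\bigl(-v_{P_\infty}(\psi_k)+uk\bigr)$, and let $z\text{-}\deg(f)$ be its degree in $z$. For $\phi,\psi\in\Omega$ write $\phi>_u\psi$ if $\deg_u(\phi)>\deg_u(\psi)$, or if $\deg_u(\phi)=\deg_u(\psi)$ and $z\text{-}\deg(\phi)>z\text{-}\deg(\psi)$. The leading monomial of a nonzero $f\in R[z]$ is the largest monomial, with respect to $>_u$, that occurs in $f$. A $Q$-polynomial of $I_M$ is a nonzero element of $I_M$ whose leading monomial is the smallest among those of all nonzero elements of $I_M$. Let $G(i)=0$ if $i$ is a Weierstrass gap at $P_\infty$ (that is, no function in $K(H)$ that is regular outside $P_\infty$ has a pole of order exactly $i$ at $P_\infty$), and $G(i)=1$ otherwise, and let $C(i)=\sum_{j=0}^{\lfloor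 i/u\rfloor}G(i-uj)$. (2) $I_M$ has a $Q$-polynomial $Q$, and it is unique up to multiplication by a nonzero constant of $\mathbb F$. (3) There is a smallest integer $w\ge 0$ with \[ 1+\sum_{i=1}^n\sum_{\gamma\in\mathbb F}\binom{m_{i\gamma}+1}{2}\le\sum_{i=0}^wC(i), \] and with $l=\lfloor w/u\rfloor$ the $Q$-polynomial satisfies $\deg_u(Q)\le w$ and $z\text{-}\deg(Q)\le l$. -/

import Mathlib

open Polynomial

/-- The Hermitian polynomial `Y^q + Y - X^(q+1)` in `F[X][Y]`. -/
noncomputable def hermitianPoly (F : Type*) [Field F] (q : ℕ) : F[X][X] :=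
  X ^ q + X - C (X ^ (q + 1))

/-- The coordinate ring `R = F[X, Y] / (Y^q + Y - X^(q+1))` of the affine Hermitian curve. -/
abbrev HermitianRing (F : Type*) [Field F] (q : ℕ) : Type _ :=
  AdjoinRoot (hermitianPoly F q)

theorem hermitianPoly_irreducible (F : Type*) [Field F] (q : ℕ) (hq : 2 ≤ q) :
    Irreducible (hermitianPoly F q) := by
  have hswap : Polynomial.Bivariate.swap (hermitianPoly F q) =
      -(X ^ (q + 1) - C (X ^ q + X) : F[X][X]) := by
    simp [hermitianPoly, Polynomial.Bivariate.swap_C, Polynomial.Bivariate.swap_Y]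
  rw [← MulEquiv.irreducible_iff (Polynomial.Bivariate.swap (R := F)), hswap]
  have hassoc : Associated (X ^ (q + 1) - C (X ^ q + X) : F[X][X])
      (-(X ^ (q + 1) - C (X ^ q + X))) := ⟨-1, by simp⟩
  rw [← hassoc.irreducible_iff]
  have hdeg : (C (X ^ q + X) : F[X][X]).degree < ((q + 1 : ℕ) : WithBot ℕ) :=
    lt_of_le_of_lt degree_C_le (by exact_mod_cast Nat.succ_pos q)
  have hmonic : (X ^ (q + 1) - C (X ^ q + X) : F[X][X]).Monic :=
    monic_X_pow_sub hdeg
  have hnat : (X ^ (q + 1) - C (X ^ q + X) : F[X][X]).natDegree = q + 1 :=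
    natDegree_X_pow_sub_C
  have hprime : (Ideal.span {(X : F[X])}).IsPrime :=
    (Ideal.span_singleton_prime X_ne_zero).2 prime_X
  refine Polynomial.IsEisensteinAt.irreducible (𝓟 := Ideal.span {(X : F[X])})
    ⟨?_, ?_, ?_⟩ hprime hmonic.isPrimitive (by omega)
  · rw [hmonic.leadingCoeff]
    exact fun h => hprime.ne_top ((Ideal.eq_top_iff_one _).2 h)
  · intro n hn
    rw [hnat] at hn
    rw [coeff_sub, coeff_X_pow, if_neg (by omega), coeff_C, zero_sub]
    split_ifs
    · refine neg_mem (Ideal.mem_span_singleton.2 ?_)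
      exact dvd_add (dvd_pow_self _ (by omega)) dvd_rfl
    · simp
  · rw [coeff_sub, coeff_X_pow, if_neg (by omega), coeff_C_zero, zero_sub,
      Ideal.span_singleton_pow, neg_mem_iff, Ideal.mem_span_singleton, X_pow_dvd_iff]
    intro h
    have h1 := h 1 (by norm_num)
    rw [coeff_add, coeff_X_pow, if_neg (by omega), coeff_X_one] at h1
    simp at h1

instance HermitianRing.instIsDomain (F : Type*) [Field F] (q : ℕ) [hq : Fact (IsPrimePow q)] :
    IsDomain (HermitianRing F q) :=
  AdjoinRoot.isDomain_of_prime
    (hermitianPoly_irreducible F q hq.out.two_le).prime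

/-- The function field `K(H)` of the Hermitian curve. -/
abbrev HermitianField (F : Type*) [Field F] (q : ℕ) : Type _ :=
  FractionRing (HermitianRing F q)

namespace Hermitian

section Affine

variable (F : Type*) [Field F] (q : ℕ)

/-- The residue class `x` of `X` in `R`. -/
noncomputable def x : HermitianRing F q := AdjoinRoot.of (hermitianPoly F q) X

/-- The residue class `y` of `Y` in `R`. -/
noncomputable def y : HermitianRing F q := AdjoinRoot.root (hermitianPoly F q)

/-- The rational points of the affine Hermitian curve. -/
abbrev RatPoint : Type _ := {P : F × F // P.2 ^ q + P.2 = P.1 ^ (q + 1)}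

variable {F q}

/-- Evaluation `φ ↦ φ(P)` of the elements of `R` at a rational point. -/
noncomputable def evalAt (P : RatPoint F q) : HermitianRing F q →+* F :=
  AdjoinRoot.lift (Polynomial.evalRingHom P.1.1) P.1.2 (by
    simp only [hermitianPoly, eval₂_sub, eval₂_add, eval₂_X_pow, eval₂_X, eval₂_C,
      coe_evalRingHom, eval_pow, eval_X, P.2, sub_self])

/-- Evaluation of the elements of `R[z]` at the rational point `(P, γ)` of `H × 𝔸¹`. -/
noncomputable def evalSurf (P : RatPoint F q) (γ : F) : (HermitianRing F q)[X] →+* F :=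
  Polynomial.eval₂RingHom (evalAt P) γ

/-- The maximal ideal of `R[z]` of the functions that vanish at `(P, γ)`. -/
noncomputable def maxIdeal (P : RatPoint F q) (γ : F) : Ideal (HermitianRing F q)[X] :=
  RingHom.ker (evalSurf P γ)

/-- The multiplicity of `f` at `(P, γ)`: the largest `r` such that `f` lies in the `r`-th power
of the maximal ideal of `(P, γ)`; it is `⊤` for `f = 0`. -/
noncomputable def mult (P : RatPoint F q) (γ : F) (f : (HermitianRing F q)[X]) : ℕ∞ :=
  sSup {e : ℕ∞ | ∃ r : ℕ, e = r ∧ f ∈ maxIdeal P γ ^ r}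

theorem le_mult_iff (P : RatPoint F q) (γ : F) (f : (HermitianRing F q)[X]) (m : ℕ) :
    (m : ℕ∞) ≤ mult P γ f ↔ f ∈ maxIdeal P γ ^ m := by
  constructor
  · intro h
    by_contra hf
    have hm : m ≠ 0 := by
      rintro rfl
      simp at hf
    have hle : mult P γ f ≤ ((m - 1 : ℕ) : ℕ∞) := by
      refine sSup_le ?_
      rintro e ⟨r, rfl, hr⟩
      rw [Nat.cast_le]
      by_contra hlt
      exact hf (Ideal.pow_le_pow_right (by omega) hr)
    have := h.trans hle
    rw [Nat.cast_le] at this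
    omega
  · intro h
    exact le_sSup ⟨m, rfl, h⟩

/-- The interpolation ideal `I_M` of a multiplicity matrix `M`. -/
noncomputable def interpIdeal (M : RatPoint F q → F → ℕ) : Ideal (HermitianRing F q)[X] where
  carrier := {f | ∀ P γ, (M P γ : ℕ∞) ≤ mult P γ f}
  add_mem' := by
    intro a b ha hb P γ
    rw [le_mult_iff]
    exact add_mem ((le_mult_iff P γ a _).1 (ha P γ)) ((le_mult_iff P γ b _).1 (hb P γ))
  zero_mem' := by
    intro P γ
    rw [le_mult_iff]
    exact zero_mem _
  smul_mem' := by
    intro c a ha P γ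
    rw [le_mult_iff]
    exact Ideal.mul_mem_left _ c ((le_mult_iff P γ a _).1 (ha P γ))

variable (F q)

/-- The set `Ω` of the monomials `x^i y^j z^k`, `j < q`, of `R[z]`. -/
def monomials : Set (HermitianRing F q)[X] :=
  {φ | ∃ i j k : ℕ, j < q ∧ φ = C (x F q ^ i * y F q ^ j) * X ^ k}

variable {F q}

/-- `f ∈ K(H)` is regular at every closed point of the affine curve `H`. -/
def RegularOnCurve (f : HermitianField F q) : Prop :=
  ∀ 𝔪 : Ideal (HermitianRing F q), 𝔪.IsMaximal → ∃ a b : HermitianRing F q, b ∉ 𝔪 ∧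
    f * algebraMap (HermitianRing F q) (HermitianField F q) b =
      algebraMap (HermitianRing F q) (HermitianField F q) a

end Affine

section Infinity

variable (F : Type*) [Field F] (q : ℕ) [Fact (IsPrimePow q)]

/-- The function `s = x / y`. The projective closure `Y^q Z + Y Z^q = X^(q+1)` has the unique point
`P_∞ = (0 : 1 : 0)` at infinity. In the affine chart `Y = 1` with the coordinates `s = X / Y = x / y`
and `t = Z / Y = 1 / y` it is the curve `t + t^q = s^(q+1)`, and `P_∞` is the origin, where `s` is
a local parameter. -/
noncomputable def sLoc : HermitianField F q :=
  algebraMap (HermitianRing F q) (HermitianField F q) (x F q) /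
    algebraMap (HermitianRing F q) (HermitianField F q) (y F q)

/-- The function `t = 1 / y`. -/
noncomputable def tLoc : HermitianField F q :=
  (algebraMap (HermitianRing F q) (HermitianField F q) (y F q))⁻¹

/-- The function on the curve given by a polynomial in the coordinates `s, t` of the chart at
infinity. -/
noncomputable def chart : MvPolynomial (Fin 2) F →ₐ[F] HermitianField F q :=
  MvPolynomial.aeval ![sLoc F q, tLoc F q]

variable {F q}

/-- `f` lies in the local ring of the projective closure at `P_∞`: it is a quotient of two
polynomials in `s, t`, whose denominator does not vanish at the origin. -/
def RegularAtInfinity (f : HermitianField F q) : Prop :=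
  ∃ a b : MvPolynomial (Fin 2) F, MvPolynomial.eval 0 b ≠ 0 ∧ f * chart F q b = chart F q a

/-- The valuation `v_{P_∞}` at nonzero elements of `K(H)`: the largest integer `r` such that
`f = s^r g` with `g` in the local ring at `P_∞`. -/
noncomputable def vInf (f : HermitianField F q) : ℤ :=
  sSup {r : ℤ | ∃ g : HermitianField F q, RegularAtInfinity g ∧ f = sLoc F q ^ r * g}

/-- The `u`-weighted degree of `f = ∑ ψ_k z^k ∈ R[z]`: the maximum of `-v_{P_∞}(ψ_k) + u k` over the
`k` with `ψ_k ≠ 0` (and `⊥` for `f = 0`). -/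
noncomputable def degU (u : ℕ) (f : (HermitianRing F q)[X]) : WithBot ℤ :=
  f.support.sup fun k =>
    ((-vInf (algebraMap (HermitianRing F q) (HermitianField F q) (f.coeff k)) + u * k : ℤ) :
      WithBot ℤ)

/-- The order `φ >_u ψ` on monomials: by `u`-weighted degree, ties being broken by `z`-degree. -/
def GtU (u : ℕ) (φ ψ : (HermitianRing F q)[X]) : Prop :=
  degU u ψ < degU u φ ∨ (degU u ψ = degU u φ ∧ ψ.natDegree < φ.natDegree)

/-- `φ` is the leading monomial of `f`: it occurs in the expansion of `f` as an `F`-linear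
combination of monomials, and it is larger than all the others that occur. -/
def IsLeadingMonomial (u : ℕ) (f : (HermitianRing F q)[X]) (φ : monomials F q) : Prop :=
  ∃ c : monomials F q →₀ F,
    Finsupp.linearCombination F (fun ψ : monomials F q => (ψ : (HermitianRing F q)[X])) c = f ∧
    φ ∈ c.support ∧ ∀ ψ ∈ c.support, ψ ≠ φ → GtU u (φ : (HermitianRing F q)[X]) ψ

/-- `Q` is a `Q`-polynomial of `I_M`: a nonzero element of `I_M` with the smallest leading monomial
among all the nonzero elements of `I_M`. -/
def IsQPolynomial (u : ℕ) (M : RatPoint F q → F → ℕ) (Q : (HermitianRing F q)[X]) : Prop :=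
  Q ∈ interpIdeal M ∧ ∃ φ : monomials F q, IsLeadingMonomial u Q φ ∧
    ∀ f ∈ interpIdeal M, ∀ ψ : monomials F q, IsLeadingMonomial u f ψ →
      ψ = φ ∨ GtU u (ψ : (HermitianRing F q)[X]) φ

variable (F q)

/-- `i` is a Weierstrass gap at `P_∞`: no function on the curve is regular outside `P_∞` and has
a pole of order exactly `i` at `P_∞`. -/
def IsGap (i : ℕ) : Prop :=
  ¬ ∃ f : HermitianField F q, f ≠ 0 ∧ RegularOnCurve f ∧ vInf f = -(i : ℤ)

open Classical in
/-- `G(i) = 0` if `i` is a Weierstrass gap at `P_∞`, and `1` otherwise. -/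
noncomputable def gapG (i : ℕ) : ℕ := if IsGap F q i then 0 else 1

/-- `C(i) = ∑_{j=0}^{⌊i/u⌋} G(i - u j)`. -/
noncomputable def countC (u i : ℕ) : ℕ :=
  ∑ j ∈ Finset.range (i / u + 1), gapG F q (i - u * j)

end Infinity

end Hermitian

/-! Two facts about the curve reduce everything to linear algebra.

Local fact: vanishing to order m at (P, γ) costs at most 1 + 2 + ... + m = binom(m+1, 2) linear
conditions. Since q = 0 in F, the Y-derivative of Y^q + Y - X^(q+1) is 1, so x - x(P) and z - γ span
the maximal ideal modulo its square (`sub_evalSurf_mem`), and the r-th layer of its powers has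
dimension at most r + 1 (`maxIdeal_pow_le`, `finrank_coordSpan_pow_le`). More monomials than
conditions leave a nontrivial combination in I_M, which is (1).

Global fact: x^i y^j with j < q has pole order qi + (q+1)j at P_∞. These orders are distinct, so
nothing cancels and -v_{P_∞} of an element of R is the largest weight in its expansion
(`vInf_algebraMap`). The upper bound on v_{P_∞} comes from embedding R in Laurent series in s = x/y;
the lower bound from explicit polynomials in s and t = 1/y. Functions regular on the affine curve
are the elements of R, so the non-gaps are exactly the weights (`not_isGap_iff`).

Distinct weights make >_u a total order embedded in lexicographic ℕ × ℕ. This gives a minimal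
leading monomial, and subtracting a multiple gives uniqueness. For (3), C(i) counts the monomials of
weighted degree i, so those of degree at most w are numerous enough for (1), and Q lies no higher
than the resulting combination. -/

namespace Hermitian

/-! ### Monomial bases of R and R[z] -/

section Basis

variable (F : Type*) [Field F] (q : ℕ)

theorem hermitianPoly_eq : hermitianPoly F q = X ^ q + (X - C (X ^ (q + 1))) := by
  rw [hermitianPoly, add_sub_assoc]

theorem degree_hermitianPoly_tail (hq : 2 ≤ q) :
    (X - C (X ^ (q + 1)) : F[X][X]).degree < (q : WithBot ℕ) := by
  rw [degree_X_sub_C]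
  exact_mod_cast hq

theorem hermitianPoly_monic (hq : 2 ≤ q) : (hermitianPoly F q).Monic := by
  rw [hermitianPoly_eq]
  exact monic_X_pow_add (degree_hermitianPoly_tail F q hq)

theorem hermitianPoly_natDegree (hq : 2 ≤ q) : (hermitianPoly F q).natDegree = q := by
  rw [hermitianPoly_eq, natDegree_add_eq_left_of_degree_lt, natDegree_X_pow]
  rw [degree_X_pow]
  exact degree_hermitianPoly_tail F q hq

theorem curve_eq : y F q ^ q + y F q = x F q ^ (q + 1) := by
  have h : AdjoinRoot.mk (hermitianPoly F q) (X ^ q + X - C (X ^ (q + 1))) = 0 :=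
    AdjoinRoot.mk_self
  simp only [map_sub, map_add, map_pow, AdjoinRoot.mk_X, AdjoinRoot.mk_C] at h
  simpa only [x, y] using sub_eq_zero.1 h

variable [hq : Fact (IsPrimePow q)]

/-- The basis `x^i y^j`, `j < q`, of `R` over `F`. -/
noncomputable def ringBasis : Module.Basis (ℕ × Fin q) F (HermitianRing F q) :=
  (Polynomial.basisMonomials F).smulTower
    ((AdjoinRoot.powerBasis' (hermitianPoly_monic F q hq.out.two_le)).basis.reindex
      (finCongr ((AdjoinRoot.powerBasis'_dim _).trans
        (hermitianPoly_natDegree F q hq.out.two_le))))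

theorem ringBasis_apply (m : ℕ × Fin q) :
    ringBasis F q m = x F q ^ m.1 * y F q ^ (m.2 : ℕ) := by
  rw [ringBasis, Module.Basis.smulTower_apply]
  simp only [coe_basisMonomials]
  rw [← X_pow_eq_monomial, Module.Basis.reindex_apply, PowerBasis.coe_basis,
    AdjoinRoot.powerBasis'_gen, Algebra.smul_def, map_pow]
  rfl

/-- The basis `x^i y^j z^k`, `j < q`, of `R[z]` over `F`. -/
noncomputable def surfBasis : Module.Basis ((ℕ × Fin q) × ℕ) F (HermitianRing F q)[X] :=
  (ringBasis F q).smulTower (Polynomial.basisMonomials (HermitianRing F q))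

theorem surfBasis_apply (m : (ℕ × Fin q) × ℕ) :
    surfBasis F q m = C (x F q ^ m.1.1 * y F q ^ (m.1.2 : ℕ)) * X ^ m.2 := by
  rw [surfBasis, Module.Basis.smulTower_apply, ringBasis_apply]
  simp only [coe_basisMonomials]
  rw [smul_monomial, smul_eq_mul, mul_one, C_mul_X_pow_eq_monomial]

theorem surfBasis_repr_apply (f : (HermitianRing F q)[X]) (m : ℕ × Fin q) (k : ℕ) :
    (surfBasis F q).repr f (m, k) = (ringBasis F q).repr (f.coeff k) m := by
  rw [surfBasis, Module.Basis.smulTower_repr]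
  rfl

theorem surfBasis_mem_monomials (m : (ℕ × Fin q) × ℕ) : surfBasis F q m ∈ monomials F q :=
  ⟨m.1.1, m.1.2, m.2, m.1.2.2, surfBasis_apply F q m⟩

/-- The exponents of the monomials of `R[z]`. -/
noncomputable def monomialEquiv : (ℕ × Fin q) × ℕ ≃ monomials F q :=
  Equiv.ofBijective (fun m => ⟨surfBasis F q m, surfBasis_mem_monomials F q m⟩)
    ⟨fun _ _ h => (surfBasis F q).injective (Subtype.ext_iff.1 h), by
      rintro ⟨_, i, j, k, hj, rfl⟩
      exact ⟨((i, ⟨j, hj⟩), k), Subtype.ext (surfBasis_apply F q _)⟩⟩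

@[simp]
theorem coe_monomialEquiv (m : (ℕ × Fin q) × ℕ) :
    (monomialEquiv F q m : (HermitianRing F q)[X]) = surfBasis F q m := rfl

/-- The monomials as a basis of `R[z]` over `F`. -/
noncomputable def monomialBasis : Module.Basis (monomials F q) F (HermitianRing F q)[X] :=
  (surfBasis F q).reindex (monomialEquiv F q)

@[simp]
theorem monomialBasis_apply (φ : monomials F q) :
    monomialBasis F q φ = (φ : (HermitianRing F q)[X]) := by
  rw [monomialBasis, Module.Basis.reindex_apply, ← coe_monomialEquiv, Equiv.apply_symm_apply]

end Basis

/-! ### Weights and the absence of cancellation -/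

section Weight

variable {q : ℕ}

/-- The pole order `q i + (q + 1) j` of `x^i y^j` at infinity. -/
def weight (m : ℕ × Fin q) : ℕ := q * m.1 + (q + 1) * m.2

/-- The weight is j + q(i + j) with j < q, so j is its residue mod q. -/
theorem weight_injective : Function.Injective (weight (q := q)) := by
  rintro ⟨i, j⟩ ⟨i', j'⟩ h
  have hj : (j : ℕ) = j' := by
    have h' := congrArg (· % q) h
    have e : ∀ (i : ℕ) (j : Fin q), weight (i, j) % q = j := by
      intro i j
      have : weight (i, j) = j + q * (i + j) := by simp only [weight]; ring
      rw [this, Nat.add_mul_mod_self_left, Nat.mod_eq_of_lt j.2]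
    simpa only [e] using h'
  have hj' : j = j' := Fin.ext hj
  subst hj'
  have hq : 0 < q := j.pos
  simp only [weight, add_left_inj] at h
  rw [Nat.eq_of_mul_eq_mul_left hq h]

variable {F : Type*} [Field F] [hq : Fact (IsPrimePow q)]

/-- The terms of r have pairwise distinct valuations, so the smallest one survives. Here `v` lives
on R only: the result is needed before R is known to embed in the Laurent series, and finiteness of
`v r` then yields that embedding. -/
theorem exists_valuation_eq_neg_weight (v : AddValuation (HermitianRing F q) (WithTop ℤ))
    (hx : v (x F q) = ((-q : ℤ) : WithTop ℤ)) (hy : v (y F q) = ((-(q + 1) : ℤ) : WithTop ℤ))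
    (hc : ∀ c : F, c ≠ 0 → v (algebraMap F _ c) = 0) {r : HermitianRing F q} (hr : r ≠ 0) :
    ∃ m ∈ ((ringBasis F q).repr r).support,
      (∀ m' ∈ ((ringBasis F q).repr r).support, weight m' ≤ weight m) ∧
      v r = ((-weight m : ℤ) : WithTop ℤ) := by
  classical
  set c := (ringBasis F q).repr r with hcdef
  have hne : c.support.Nonempty := by
    rw [Finsupp.support_nonempty_iff]
    simpa [hcdef] using hr
  obtain ⟨m, hm, hmax⟩ := Finset.exists_max_image c.support weight hne
  refine ⟨m, hm, hmax, ?_⟩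
  have hterm : ∀ m' ∈ c.support,
      v (c m' • ringBasis F q m') = ((-weight m' : ℤ) : WithTop ℤ) := by
    intro m' hm'
    rw [ringBasis_apply, Algebra.smul_def, v.map_mul, hc _ (Finsupp.mem_support_iff.1 hm'),
      v.map_mul, v.map_pow, v.map_pow, hx, hy, zero_add, ← WithTop.coe_nsmul,
      ← WithTop.coe_nsmul, ← WithTop.coe_add]
    congr 1
    simp only [weight, nsmul_eq_mul]
    push_cast
    ring
  have hsum : r = ∑ m' ∈ c.support, c m' • ringBasis F q m' := by
    conv_lhs => rw [← (ringBasis F q).linearCombination_repr r]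
    rfl
  have hlt : v (c m • ringBasis F q m) <
      v (∑ m' ∈ c.support.erase m, c m' • ringBasis F q m') := by
    refine v.map_lt_sum ?_ ?_
    · rw [hterm m hm]
      exact WithTop.coe_ne_top
    · intro m' hm'
      obtain ⟨h1, h2⟩ := Finset.mem_erase.1 hm'
      rw [hterm m hm, hterm m' h2, WithTop.coe_lt_coe, neg_lt_neg_iff, Nat.cast_lt]
      exact lt_of_le_of_ne (hmax m' h2) fun h => h1 (weight_injective h)
  rw [hsum, ← Finset.add_sum_erase _ _ hm, ← hterm m hm]
  exact v.map_add_eq_of_lt_left hlt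

end Weight

/-! ### A valuation of the function field from Laurent series -/

section Valuation

theorem comap_apply {A B : Type*} [CommRing A] [CommRing B]
    (v : AddValuation B (WithTop ℤ)) (f : A →+* B) (a : A) : v.comap f a = v (f a) := rfl

variable (F : Type*) [Field F] (q : ℕ) [hq : Fact (IsPrimePow q)]

/-- Hensel's lemma: modulo X the polynomial T^q + T - X^(q+1) has the simple root 0, its derivative
there being 1. -/
theorem exists_powerSeries_root :
    ∃ t : PowerSeries F, t ^ q + t = PowerSeries.X ^ (q + 1) ∧
      t ∈ Ideal.span {(PowerSeries.X : PowerSeries F)} := by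
  have hq2 := hq.out.two_le
  have hd : (X - C (PowerSeries.X ^ (q + 1)) : (PowerSeries F)[X]).degree < (q : WithBot ℕ) := by
    rw [degree_X_sub_C]
    exact_mod_cast hq2
  obtain ⟨t, ht, ht0⟩ := HenselianRing.is_henselian
    (I := Ideal.span {(PowerSeries.X : PowerSeries F)})
    (X ^ q + (X - C (PowerSeries.X ^ (q + 1)))) (monic_X_pow_add hd) 0 (by
      simp only [eval_add, eval_sub, eval_pow, eval_X, eval_C]
      rw [zero_pow (by omega), zero_add, zero_sub, neg_mem_iff]
      exact Ideal.pow_mem_of_mem _ (Ideal.mem_span_singleton_self _) _ (by omega)) (by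
      have : eval 0 (derivative (X ^ q + (X - C (PowerSeries.X ^ (q + 1))) : (PowerSeries F)[X]))
          = 1 := by
        rw [derivative_add, derivative_sub, derivative_C, derivative_X_pow, derivative_X]
        simp [show q - 1 ≠ 0 by omega]
      rw [this, map_one]
      exact isUnit_one)
  refine ⟨t, ?_, by simpa using ht0⟩
  simp only [IsRoot, eval_add, eval_sub, eval_pow, eval_X, eval_C] at ht
  linear_combination ht

/-- Here t(1 + t^(q-1)) = s^(q+1), and the bracket has valuation 0 because t has positive valuation
and q ≥ 2. -/
theorem exists_laurentSeries_root :
    ∃ s t : LaurentSeries F, t ^ q + t = s ^ (q + 1) ∧ HahnSeries.addVal ℤ F s = (1 : ℤ) ∧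
      HahnSeries.addVal ℤ F t = (q + 1 : ℤ) := by
  have hq2 := hq.out.two_le
  obtain ⟨t, ht, ht0⟩ := exists_powerSeries_root F q
  obtain ⟨b, rfl⟩ := Ideal.mem_span_singleton.1 ht0
  set v := HahnSeries.addVal ℤ F
  let φ := HahnSeries.ofPowerSeries ℤ F
  have hs : v (φ PowerSeries.X) = (1 : ℤ) := by
    rw [HahnSeries.ofPowerSeries_X, HahnSeries.addVal_apply, HahnSeries.orderTop_single one_ne_zero]
  have hφ : ∀ p, 0 ≤ v (φ p) := by
    intro p
    rw [HahnSeries.addVal_apply]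
    by_contra h
    obtain ⟨n, hn⟩ := WithTop.ne_top_iff_exists.1 (ne_top_of_lt (not_le.1 h))
    rw [← hn] at h
    have hn0 : n < 0 := by
      by_contra h'
      exact h (by exact_mod_cast not_lt.1 h')
    refine HahnSeries.coeff_orderTop_ne hn.symm ?_
    have : n ∉ Set.range (Nat.cast : ℕ → ℤ) := by
      rintro ⟨k, rfl⟩
      omega
    exact HahnSeries.embDomain_of_notMem_range (by simpa using this)
  refine ⟨φ PowerSeries.X, φ (PowerSeries.X * b), by rw [← map_pow, ← map_pow, ← map_add, ht],
    hs, ?_⟩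
  have hpos : (0 : WithTop ℤ) < v (φ (PowerSeries.X * b) ^ (q - 1)) := by
    have h1 : ((1 : ℤ) : WithTop ℤ) ≤ v (φ (PowerSeries.X * (b *
        (PowerSeries.X * b) ^ (q - 2)))) := by
      rw [map_mul φ, v.map_mul, hs]
      exact le_add_of_nonneg_right (hφ _)
    have h2 : φ (PowerSeries.X * b) ^ (q - 1) = φ (PowerSeries.X * (b *
        (PowerSeries.X * b) ^ (q - 2))) := by
      rw [← map_pow, show q - 1 = (q - 2) + 1 by omega, pow_succ]
      congr 1
      ring
    rw [h2]
    exact lt_of_lt_of_le (by exact_mod_cast zero_lt_one) h1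
  have hunit : v (1 + φ (PowerSeries.X * b) ^ (q - 1)) = 0 := by
    rw [← v.map_one] at hpos
    rw [v.map_add_eq_of_lt_left hpos, v.map_one]
  have hmul : φ (PowerSeries.X * b) * (1 + φ (PowerSeries.X * b) ^ (q - 1)) =
      φ PowerSeries.X ^ (q + 1) := by
    rw [mul_add, ← pow_succ', Nat.sub_add_cancel (by omega), mul_one, ← map_pow φ _ q,
      ← map_pow, ← map_add, ← ht, add_comm]
  have := congrArg v hmul
  rw [v.map_mul, hunit, add_zero, v.map_pow, hs, ← WithTop.coe_nsmul] at this
  rw [this]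
  simp

/-- There is a valuation of the function field with poles of order `q`, `q + 1` of `x`, `y`. -/
theorem exists_addValuation : ∃ v : AddValuation (HermitianField F q) (WithTop ℤ),
    v (algebraMap (HermitianRing F q) _ (x F q)) = ((-q : ℤ) : WithTop ℤ) ∧
    v (algebraMap (HermitianRing F q) _ (y F q)) = ((-(q + 1) : ℤ) : WithTop ℤ) ∧
    ∀ c : F, c ≠ 0 → v (algebraMap F _ c) = 0 := by
  obtain ⟨s, t, hst, hs, ht⟩ := exists_laurentSeries_root F q
  set v := HahnSeries.addVal ℤ F
  have hs0 : s ≠ 0 := v.ne_top_iff.1 (by rw [hs]; exact WithTop.coe_ne_top)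
  have ht0 : t ≠ 0 := v.ne_top_iff.1 (by rw [ht]; exact WithTop.coe_ne_top)
  let ψ : F[X] →+* LaurentSeries F := (aeval (s / t) : F[X] →ₐ[F] LaurentSeries F).toRingHom
  -- Inverts s = x/y, t = 1/y; the relation t^q + t = s^(q+1) divided by t^(q+1) is the affine
  -- equation.
  let φ : HermitianRing F q →+* LaurentSeries F := AdjoinRoot.lift ψ t⁻¹ (by
    have : ψ X = s / t := aeval_X _
    simp only [hermitianPoly, eval₂_sub, eval₂_add, eval₂_X_pow, eval₂_X, eval₂_C]
    rw [map_pow ψ, this]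
    have e : t⁻¹ ^ q = t / t ^ (q + 1) := by rw [pow_succ, inv_pow]; field_simp
    have e' : t⁻¹ = t ^ q / t ^ (q + 1) := by rw [pow_succ]; field_simp
    rw [e, div_pow, ← hst, e']
    ring)
  have hx : φ (x F q) = s / t := by
    simp only [φ, x, AdjoinRoot.lift_of]
    exact aeval_X _
  have hy : φ (y F q) = t⁻¹ := by simp only [φ, y, AdjoinRoot.lift_root]
  have hcF : ∀ c : F, φ (algebraMap F _ c) = algebraMap F _ c := by
    intro c
    rw [AdjoinRoot.algebraMap_eq', RingHom.comp_apply, AdjoinRoot.lift_of]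
    exact aeval_C _ _
  have hvx : v (s / t) = ((-q : ℤ) : WithTop ℤ) := by
    have h : v (s / t) + v t = v s := by rw [← v.map_mul, div_mul_cancel₀ _ ht0]
    rw [hs, ht] at h
    obtain ⟨n, hn⟩ := WithTop.ne_top_iff_exists.1 (v.ne_top_iff.2 (div_ne_zero hs0 ht0))
    rw [← hn] at h ⊢
    norm_cast at h ⊢
    push_cast at h
    omega
  have hvy : v t⁻¹ = ((-(q + 1) : ℤ) : WithTop ℤ) := by
    have h : v t⁻¹ + v t = 0 := by rw [← v.map_mul, inv_mul_cancel₀ ht0, v.map_one]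
    rw [ht] at h
    obtain ⟨n, hn⟩ := WithTop.ne_top_iff_exists.1 (v.ne_top_iff.2 (inv_ne_zero ht0))
    rw [← hn] at h ⊢
    norm_cast at h ⊢
    push_cast at h
    omega
  have hvc : ∀ c : F, c ≠ 0 → v (algebraMap F _ c) = 0 := by
    intro c hc
    have : algebraMap F (LaurentSeries F) c = HahnSeries.single 0 c := by
      rw [HahnSeries.algebraMap_apply']
      simp
    rw [this, HahnSeries.addVal_apply, HahnSeries.orderTop_single hc]
    rfl
  have hinj : Function.Injective φ := by
    rw [injective_iff_map_eq_zero]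
    intro r hr
    by_contra h0
    obtain ⟨m, -, -, hm⟩ := exists_valuation_eq_neg_weight (v.comap φ)
      (by rw [comap_apply, hx, hvx]) (by rw [comap_apply, hy, hvy])
      (fun c hc => by rw [comap_apply, hcF, hvc c hc]) h0
    rw [comap_apply, hr, v.map_zero] at hm
    exact WithTop.coe_ne_top hm.symm
  refine ⟨v.comap (IsFractionRing.lift hinj : HermitianField F q →+* LaurentSeries F), ?_, ?_, ?_⟩
  · rw [comap_apply, IsFractionRing.lift_algebraMap, hx, hvx]
  · rw [comap_apply, IsFractionRing.lift_algebraMap, hy, hvy]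
  · intro c hc
    rw [comap_apply, IsScalarTower.algebraMap_apply F (HermitianRing F q),
      IsFractionRing.lift_algebraMap, hcF, hvc c hc]

end Valuation
-- Functions regular on the affine curve
section Regular

variable {F : Type*} [Field F] {q : ℕ}

/-- The ideal of denominators of f lies in no maximal ideal, hence contains 1. -/
theorem RegularOnCurve.exists_eq_algebraMap {f : HermitianField F q} (hf : RegularOnCurve f) :
    ∃ r : HermitianRing F q, f = algebraMap _ _ r := by
  let I : Ideal (HermitianRing F q) :=
    { carrier := {b | ∃ a : HermitianRing F q, f * algebraMap _ _ b = algebraMap _ _ a}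
      add_mem' := by
        rintro b b' ⟨a, h⟩ ⟨a', h'⟩
        exact ⟨a + a', by rw [map_add, map_add, mul_add, h, h']⟩
      zero_mem' := ⟨0, by simp⟩
      smul_mem' := by
        rintro c b ⟨a, h⟩
        exact ⟨c * a, by rw [smul_eq_mul, map_mul, map_mul, mul_left_comm, h]⟩ }
  have hI : I = ⊤ := by
    by_contra h
    obtain ⟨𝔪, hm, hle⟩ := Ideal.exists_le_maximal I h
    obtain ⟨a, b, hb, hab⟩ := hf 𝔪 hm
    exact hb (hle ⟨a, hab⟩)
  obtain ⟨a, ha⟩ := (Ideal.eq_top_iff_one I).1 hI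
  exact ⟨a, by simpa using ha⟩

theorem regularOnCurve_algebraMap (r : HermitianRing F q) :
    RegularOnCurve (algebraMap _ (HermitianField F q) r) := fun 𝔪 h =>
  ⟨r, 1, fun h1 => h.ne_top ((Ideal.eq_top_iff_one _).2 h1), by simp⟩

end Regular

/-! ### The valuation at infinity and the gaps -/

section Infinity

variable {F : Type*} [Field F] {q : ℕ} [hq : Fact (IsPrimePow q)]

theorem algebraMap_x_y_ne_zero :
    algebraMap (HermitianRing F q) (HermitianField F q) (x F q) ≠ 0 ∧
    algebraMap (HermitianRing F q) (HermitianField F q) (y F q) ≠ 0 := by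
  obtain ⟨v, hx, hy, -⟩ := exists_addValuation F q
  constructor <;> rw [← v.ne_top_iff] <;> simp only [hx, hy] <;> exact WithTop.coe_ne_top

/-- This is the curve equation divided by y^q. It makes s^q x a polynomial in t. -/
theorem sLoc_pow_mul_x : sLoc F q ^ q * algebraMap (HermitianRing F q) (HermitianField F q) (x F q) =
    1 + tLoc F q ^ (q - 1) := by
  obtain ⟨-, hy⟩ := algebraMap_x_y_ne_zero (F := F) (q := q)
  have h := congrArg (algebraMap (HermitianRing F q) (HermitianField F q)) (curve_eq F q)
  rw [map_add, map_pow, map_pow] at h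
  have hq2 := hq.out.two_le
  rw [sLoc, tLoc, div_pow, div_mul_eq_mul_div, ← pow_succ, ← h, add_div,
    div_self (pow_ne_zero _ hy), inv_pow]
  congr 1
  rw [div_eq_iff (pow_ne_zero _ hy)]
  obtain ⟨k, rfl⟩ : ∃ k, q = k + 1 := ⟨q - 1, by omega⟩
  rw [Nat.add_sub_cancel]
  rw [pow_succ, inv_mul_cancel_left₀ (pow_ne_zero _ hy)]

theorem sLoc_pow_mul_y :
    sLoc F q ^ (q + 1) * algebraMap (HermitianRing F q) (HermitianField F q) (y F q) =
      1 + tLoc F q ^ (q - 1) := by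
  obtain ⟨-, hy⟩ := algebraMap_x_y_ne_zero (F := F) (q := q)
  rw [← sLoc_pow_mul_x, pow_succ, mul_assoc]
  congr 1
  rw [sLoc, div_mul_cancel₀ _ hy]

theorem sLoc_pow_weight_mul (m : ℕ × Fin q) :
    sLoc F q ^ weight m * algebraMap (HermitianRing F q) (HermitianField F q) (ringBasis F q m) =
      (1 + tLoc F q ^ (q - 1)) ^ (m.1 + m.2 : ℕ) := by
  rw [ringBasis_apply, map_mul, map_pow, map_pow, weight, pow_add, pow_mul,
    pow_mul, mul_mul_mul_comm, ← mul_pow, ← mul_pow, sLoc_pow_mul_x, sLoc_pow_mul_y, ← pow_add]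

theorem sLoc_ne_zero : sLoc F q ≠ 0 :=
  div_ne_zero algebraMap_x_y_ne_zero.1 algebraMap_x_y_ne_zero.2

theorem sLoc_mem_range : sLoc F q ∈ (chart F q).range :=
  ⟨MvPolynomial.X 0, by simp [chart]⟩

theorem tLoc_mem_range : tLoc F q ∈ (chart F q).range :=
  ⟨MvPolynomial.X 1, by simp [chart]⟩

theorem regularAtInfinity_of_mem_range {f : HermitianField F q} (hf : f ∈ (chart F q).range) :
    RegularAtInfinity f := by
  obtain ⟨a, rfl⟩ := hf
  exact ⟨a, 1, by simp, by simp⟩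

/-- Each basis element of weight d ≤ N contributes s^(N-d) times a power of 1 + t^(q-1), so no
denominator is needed. -/
theorem regularAtInfinity_sLoc_pow_mul {r : HermitianRing F q} {N : ℕ}
    (hN : ∀ m ∈ ((ringBasis F q).repr r).support, weight m ≤ N) :
    RegularAtInfinity (sLoc F q ^ N * algebraMap (HermitianRing F q) (HermitianField F q) r) := by
  refine regularAtInfinity_of_mem_range ?_
  have hsum : r = ∑ m ∈ ((ringBasis F q).repr r).support,
      (ringBasis F q).repr r m • ringBasis F q m := by
    conv_lhs => rw [← (ringBasis F q).linearCombination_repr r]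
    rfl
  rw [hsum, map_sum, Finset.mul_sum]
  refine sum_mem fun m hm => ?_
  have hsmul : ∀ (c : F) (b : HermitianRing F q), algebraMap _ (HermitianField F q) (c • b) =
      c • algebraMap _ (HermitianField F q) b :=
    fun c b => map_smul (IsScalarTower.toAlgHom F (HermitianRing F q) (HermitianField F q)) c b
  rw [hsmul, mul_smul_comm]
  refine Subalgebra.smul_mem _ ?_ _
  rw [← Nat.sub_add_cancel (hN m hm), pow_add, mul_assoc, sLoc_pow_weight_mul]
  exact mul_mem (pow_mem sLoc_mem_range _)
    (pow_mem (add_mem (one_mem _) (pow_mem tLoc_mem_range _)) _)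

theorem valuation_zpow {K : Type*} [Field K] (v : AddValuation K (WithTop ℤ)) {s : K}
    (hs : v s = (1 : ℤ)) (r : ℤ) : v (s ^ r) = r := by
  have h1 : ∀ n : ℕ, v (s ^ n) = ((n : ℤ) : WithTop ℤ) := by
    intro n
    rw [v.map_pow, hs, ← WithTop.coe_nsmul]
    simp
  cases r with
  | ofNat n => simpa using h1 n
  | negSucc n =>
    have hs0 : s ≠ 0 := v.ne_top_iff.1 (by rw [hs]; exact WithTop.coe_ne_top)
    have h : v (s ^ Int.negSucc n) + v (s ^ (n + 1)) = 0 := by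
      rw [← v.map_mul, zpow_negSucc, inv_mul_cancel₀ (pow_ne_zero _ hs0), v.map_one]
    rw [h1] at h
    obtain ⟨k, hk⟩ := WithTop.ne_top_iff_exists.1
      (v.ne_top_iff.2 (zpow_ne_zero (Int.negSucc n) hs0))
    rw [← hk] at h ⊢
    norm_cast at h ⊢
    push_cast at h
    omega

theorem valuation_chart_sub_pos (v : AddValuation (HermitianField F q) (WithTop ℤ))
    (hc : ∀ c : F, c ≠ 0 → v (algebraMap F _ c) = 0) (hs : 0 < v (sLoc F q))
    (ht : 0 < v (tLoc F q)) (p : MvPolynomial (Fin 2) F) :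
    0 < v (chart F q p - algebraMap F _ (MvPolynomial.eval 0 p)) := by
  have hc' : ∀ c : F, 0 ≤ v (algebraMap F _ c) := by
    intro c
    rcases eq_or_ne c 0 with rfl | h
    · simp
    · exact (hc c h).ge
  induction p using MvPolynomial.induction_on with
  | C a => simp [chart]
  | add p p' h h' =>
    rw [map_add, map_add, map_add, add_sub_add_comm]
    exact v.map_lt_add h h'
  | mul_X p i h =>
    have h0 : 0 ≤ v (chart F q p) := by
      rw [← sub_add_cancel (chart F q p) (algebraMap F _ (MvPolynomial.eval 0 p))]
      exact v.map_le_add h.le (hc' _)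
    have hX : 0 < v (chart F q (MvPolynomial.X i)) := by
      fin_cases i
      · simpa [chart] using hs
      · simpa [chart] using ht
    have : MvPolynomial.eval 0 (p * MvPolynomial.X i) = 0 := by simp
    rw [this, map_zero, sub_zero, map_mul, v.map_mul]
    exact lt_of_lt_of_le hX (le_add_of_nonneg_left h0)

/-- A polynomial in s, t differs from its constant term by something of positive valuation; so a
denominator not vanishing at the origin has valuation 0. -/
theorem valuation_nonneg_of_regularAtInfinity
    (v : AddValuation (HermitianField F q) (WithTop ℤ))
    (hc : ∀ c : F, c ≠ 0 → v (algebraMap F _ c) = 0) (hs : 0 < v (sLoc F q))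
    (ht : 0 < v (tLoc F q)) {f : HermitianField F q} (hf : RegularAtInfinity f) : 0 ≤ v f := by
  obtain ⟨a, b, hb, h⟩ := hf
  have hvb : v (chart F q b) = 0 := by
    rw [← sub_add_cancel (chart F q b) (algebraMap F _ (MvPolynomial.eval 0 b)), ← hc _ hb]
    refine v.map_add_eq_of_lt_right ?_
    rw [hc _ hb]
    exact valuation_chart_sub_pos v hc hs ht b
  have hva : 0 ≤ v (chart F q a) := by
    rw [← sub_add_cancel (chart F q a) (algebraMap F _ (MvPolynomial.eval 0 a))]
    refine v.map_le_add (valuation_chart_sub_pos v hc hs ht a).le ?_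
    rcases eq_or_ne (MvPolynomial.eval 0 a) 0 with h | h
    · rw [h]
      simp
    · exact (hc _ h).ge
  rw [← h, v.map_mul, hvb, add_zero] at hva
  exact hva

theorem vInf_algebraMap {r : HermitianRing F q} (hr : r ≠ 0) :
    ∃ m ∈ ((ringBasis F q).repr r).support,
      (∀ m' ∈ ((ringBasis F q).repr r).support, weight m' ≤ weight m) ∧
      vInf (algebraMap (HermitianRing F q) (HermitianField F q) r) = -(weight m : ℤ) := by
  obtain ⟨v, hx, hy, hc⟩ := exists_addValuation F q
  obtain ⟨m, hm, hmax, hv⟩ := exists_valuation_eq_neg_weight (v.comap (algebraMap _ _)) hx hy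
    (fun c h => by
      rw [comap_apply, ← IsScalarTower.algebraMap_apply F (HermitianRing F q), hc c h]) hr
  refine ⟨m, hm, hmax, ?_⟩
  have ht : v (tLoc F q) = ((q + 1 : ℤ) : WithTop ℤ) := by
    have h : v (tLoc F q) + v (algebraMap _ _ (y F q)) = 0 := by
      rw [← v.map_mul, tLoc, inv_mul_cancel₀ algebraMap_x_y_ne_zero.2, v.map_one]
    have ht0 : tLoc F q ≠ 0 := inv_ne_zero algebraMap_x_y_ne_zero.2
    obtain ⟨k, hk⟩ := WithTop.ne_top_iff_exists.1 (v.ne_top_iff.2 ht0)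
    rw [hy, ← hk] at h
    rw [← hk]
    norm_cast at h ⊢
    omega
  have hs : v (sLoc F q) = ((1 : ℤ) : WithTop ℤ) := by
    have : sLoc F q = algebraMap _ _ (x F q) * tLoc F q := div_eq_mul_inv _ _
    rw [this, v.map_mul, hx, ht, ← WithTop.coe_add]
    congr 1
    ring
  have hs' : 0 < v (sLoc F q) := by
    rw [hs]
    exact_mod_cast zero_lt_one
  have ht' : 0 < v (tLoc F q) := by
    rw [ht]
    exact_mod_cast (by omega : (0 : ℤ) < q + 1)
  -- Exhibiting a greatest element also rules out the junk value of `sSup` on an unbounded set of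
  -- integers.
  refine IsGreatest.csSup_eq ⟨⟨_, regularAtInfinity_sLoc_pow_mul hmax, ?_⟩, ?_⟩
  · rw [zpow_neg, zpow_natCast, inv_mul_cancel_left₀ (pow_ne_zero _ sLoc_ne_zero)]
  · rintro k ⟨g, hg, h⟩
    have hg0 := valuation_nonneg_of_regularAtInfinity v hc hs' ht' hg
    have hvr : v (algebraMap _ _ r) = ((-weight m : ℤ) : WithTop ℤ) := hv
    rw [h, v.map_mul, valuation_zpow v hs] at hvr
    have : (k : WithTop ℤ) ≤ ((-weight m : ℤ) : WithTop ℤ) := by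
      rw [← hvr]
      exact le_add_of_nonneg_right hg0
    exact_mod_cast this

theorem vInf_ringBasis (m : ℕ × Fin q) :
    vInf (algebraMap (HermitianRing F q) (HermitianField F q) (ringBasis F q m)) =
      -(weight m : ℤ) := by
  obtain ⟨m', hm', -, h⟩ := vInf_algebraMap ((ringBasis F q).ne_zero m)
  rw [Module.Basis.repr_self] at hm'
  rwa [Finset.mem_singleton.1 (Finsupp.support_single_subset hm')] at h

theorem not_isGap_iff (i : ℕ) : ¬ IsGap F q i ↔ ∃ m : ℕ × Fin q, weight m = i := by
  rw [IsGap, not_not]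
  constructor
  · rintro ⟨f, hf0, hf, hv⟩
    obtain ⟨r, rfl⟩ := hf.exists_eq_algebraMap
    obtain ⟨m, -, -, hm⟩ := vInf_algebraMap (r := r) (by rintro rfl; simp at hf0)
    exact ⟨m, by rw [hv] at hm; omega⟩
  · rintro ⟨m, rfl⟩
    refine ⟨algebraMap _ _ (ringBasis F q m), ?_, regularOnCurve_algebraMap _, vInf_ringBasis m⟩
    simpa using (ringBasis F q).ne_zero m

end Infinity
-- Counting the conditions imposed by multiplicities
section Multiplicity

variable {F : Type*} [Field F] {q : ℕ}

@[simp]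
theorem evalAt_x (P : RatPoint F q) : evalAt P (x F q) = P.1.1 := by
  simp [evalAt, x]

@[simp]
theorem evalAt_y (P : RatPoint F q) : evalAt P (y F q) = P.1.2 := by
  simp [evalAt, y]

@[simp]
theorem evalSurf_C (P : RatPoint F q) (γ : F) (r : HermitianRing F q) :
    evalSurf P γ (C r) = evalAt P r := by
  simp [evalSurf]

@[simp]
theorem evalSurf_X (P : RatPoint F q) (γ : F) : evalSurf P γ X = γ := by
  simp [evalSurf]

@[simp]
theorem evalAt_algebraMap (P : RatPoint F q) (c : F) : evalAt P (algebraMap F _ c) = c := by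
  rw [AdjoinRoot.algebraMap_eq', RingHom.comp_apply, evalAt, AdjoinRoot.lift_of]
  exact eval_C

theorem evalSurf_algebraMap (P : RatPoint F q) (γ c : F) :
    evalSurf P γ (algebraMap F _ c) = c := by
  rw [Polynomial.algebraMap_apply, evalSurf_C, evalAt_algebraMap]

theorem mem_maxIdeal {P : RatPoint F q} {γ : F} {f : (HermitianRing F q)[X]} :
    f ∈ maxIdeal P γ ↔ evalSurf P γ f = 0 := RingHom.mem_ker

/-- The span over `F` of the local coordinates `x - x(P)` and `z - γ`. -/
noncomputable def coordSpan (P : RatPoint F q) (γ : F) : Submodule F (HermitianRing F q)[X] :=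
  Submodule.span F {C (x F q) - algebraMap F _ P.1.1, X - algebraMap F _ γ}

theorem coordSpan_le (P : RatPoint F q) (γ : F) :
    coordSpan P γ ≤ (maxIdeal P γ).restrictScalars F := by
  rw [coordSpan, Submodule.span_le]
  rintro f (rfl | rfl) <;>
    simp [mem_maxIdeal]

theorem coordSpan_pow_le (P : RatPoint F q) (γ : F) (r : ℕ) :
    coordSpan P γ ^ r ≤ (maxIdeal P γ ^ r).restrictScalars F := by
  induction r with
  | zero => simp
  | succ r ih =>
    rw [pow_succ, pow_succ]
    refine Submodule.mul_le.2 fun f hf g hg => ?_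
    exact Ideal.mul_mem_mul (ih hf) (coordSpan_le P γ hg)

theorem y_sub_mem (hchar : (q : F) = 0) (P : RatPoint F q) (γ : F) :
    C (y F q) - algebraMap F _ P.1.2 ∈
      coordSpan P γ ⊔ (maxIdeal P γ ^ 2).restrictScalars F := by
  have hx : C (x F q) - algebraMap F _ P.1.1 ∈ maxIdeal P γ := by simp [mem_maxIdeal]
  have hy : C (y F q) - algebraMap F _ P.1.2 ∈ maxIdeal P γ := by simp [mem_maxIdeal]
  set A := (HermitianRing F q)[X]
  set a : A := algebraMap F _ P.1.1
  set b : A := algebraMap F _ P.1.2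
  obtain ⟨k, hk⟩ := Polynomial.powAddExpansion b (C (y F q) - b) q
  obtain ⟨l, hl⟩ := Polynomial.powAddExpansion a (C (x F q) - a) (q + 1)
  rw [add_sub_cancel] at hk hl
  have hqA : (q : A) = 0 := by
    rw [← map_natCast (algebraMap F A), hchar, map_zero]
  have hcurve : (C (y F q) : A) ^ q + C (y F q) = C (x F q) ^ (q + 1) := by
    rw [← C_pow, ← C_add, curve_eq, C_pow]
  have hP : b ^ q + b = a ^ (q + 1) := by
    simp only [a, b, ← map_pow, ← map_add, P.2]
  -- Taylor expansion of both sides of the curve equation to second order: with q = 0 in F, the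
  -- linear terms are y - b and a^q (x - a).
  have key : C (y F q) - b = (P.1.1 ^ q) • (C (x F q) - a) +
      (l * (C (x F q) - a) ^ 2 - k * (C (y F q) - b) ^ 2) := by
    rw [Algebra.smul_def, map_pow]
    push_cast [Nat.add_sub_cancel] at hk hl
    rw [hqA] at hk hl
    linear_combination hcurve - hk - hP + hl
  rw [key]
  refine Submodule.add_mem_sup (Submodule.smul_mem _ _ (Submodule.subset_span (Set.mem_insert _ _))) ?_
  exact sub_mem (Ideal.mul_mem_left _ _ (Ideal.pow_mem_pow hx 2))
    (Ideal.mul_mem_left _ _ (Ideal.pow_mem_pow hy 2))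

variable [hq : Fact (IsPrimePow q)]

/-- By the Leibniz identity modulo the squared maximal ideal, the f with this property form a
subalgebra; it contains x, y and z. -/
theorem sub_evalSurf_mem (hchar : (q : F) = 0) (P : RatPoint F q) (γ : F)
    (f : (HermitianRing F q)[X]) : f - algebraMap F _ (evalSurf P γ f) ∈
      coordSpan P γ ⊔ (maxIdeal P γ ^ 2).restrictScalars F := by
  set N := coordSpan P γ ⊔ (maxIdeal P γ ^ 2).restrictScalars F
  let S : Subalgebra F (HermitianRing F q)[X] :=
    { carrier := {f | f - algebraMap F _ (evalSurf P γ f) ∈ N}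
      mul_mem' := by
        intro f g hf hg
        have e : f * g - algebraMap F _ (evalSurf P γ (f * g)) =
            (f - algebraMap F _ (evalSurf P γ f)) * (g - algebraMap F _ (evalSurf P γ g)) +
              (evalSurf P γ f • (g - algebraMap F _ (evalSurf P γ g)) +
              evalSurf P γ g • (f - algebraMap F _ (evalSurf P γ f))) := by
          rw [Algebra.smul_def, Algebra.smul_def, map_mul, map_mul]
          ring
        rw [Set.mem_ofPred_eq, e]
        refine add_mem (Submodule.mem_sup_right ?_)
          (add_mem (N.smul_mem _ hg) (N.smul_mem _ hf))
        rw [Submodule.restrictScalars_mem, pow_two]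
        exact Ideal.mul_mem_mul (by simp [mem_maxIdeal]) (by simp [mem_maxIdeal])
      add_mem' := by
        intro f g hf hg
        rw [Set.mem_ofPred_eq, map_add, map_add, add_sub_add_comm]
        exact add_mem hf hg
      algebraMap_mem' := fun c => by
        rw [Set.mem_ofPred_eq, evalSurf_algebraMap, sub_self]
        exact N.zero_mem }
  suffices S = ⊤ from (this ▸ Algebra.mem_top : f ∈ S)
  have hx : C (x F q) ∈ S := by
    change _ - _ ∈ N
    rw [evalSurf_C, evalAt_x]
    exact Submodule.mem_sup_left (Submodule.subset_span (by simp))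
  have hy : C (y F q) ∈ S := by
    change _ - _ ∈ N
    rw [evalSurf_C, evalAt_y]
    exact y_sub_mem hchar P γ
  have hz : X ∈ S := by
    change _ - _ ∈ N
    rw [evalSurf_X]
    exact Submodule.mem_sup_left (Submodule.subset_span (by simp))
  rw [← Algebra.toSubmodule_eq_top, eq_top_iff, ← (surfBasis F q).span_eq, Submodule.span_le]
  rintro _ ⟨m, rfl⟩
  rw [surfBasis_apply, C_mul, C_pow, C_pow]
  exact S.mul_mem (S.mul_mem (S.pow_mem hx _) (S.pow_mem hy _)) (S.pow_mem hz _)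

theorem maxIdeal_pow_le (hchar : (q : F) = 0) (P : RatPoint F q) (γ : F) (r : ℕ) :
    (maxIdeal P γ ^ r).restrictScalars F ≤
      coordSpan P γ ^ r ⊔ (maxIdeal P γ ^ (r + 1)).restrictScalars F := by
  induction r with
  | zero =>
    intro f _
    rw [← add_sub_cancel (algebraMap F _ (evalSurf P γ f)) f]
    refine Submodule.add_mem_sup ?_ ?_
    · rw [pow_zero]
      exact Submodule.algebraMap_mem _
    · rw [zero_add, pow_one, Submodule.restrictScalars_mem]
      simp [mem_maxIdeal]
  | succ r ih =>
    intro f hf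
    rw [Submodule.restrictScalars_mem, pow_succ] at hf
    refine Submodule.mul_induction_on hf (fun f hf g hg => ?_) fun f g hf hg => add_mem hf hg
    obtain ⟨f₁, hf₁, f₂, hf₂, rfl⟩ := Submodule.mem_sup.1 (ih hf)
    have hg' := sub_evalSurf_mem hchar P γ g
    rw [mem_maxIdeal.1 hg, map_zero, sub_zero] at hg'
    obtain ⟨g₁, hg₁, g₂, hg₂, rfl⟩ := Submodule.mem_sup.1 hg'
    have e : (f₁ + f₂) * (g₁ + g₂) = f₁ * g₁ + (f₁ * g₂ + f₂ * (g₁ + g₂)) := by ring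
    rw [e]
    refine Submodule.add_mem_sup ?_ ?_
    · rw [pow_succ]
      exact Submodule.mul_mem_mul hf₁ hg₁
    · refine add_mem ?_ ?_
      · rw [Submodule.restrictScalars_mem, show r + 1 + 1 = r + 2 by ring, pow_add]
        exact Ideal.mul_mem_mul (coordSpan_pow_le P γ r hf₁) hg₂
      · rw [Submodule.restrictScalars_mem, pow_succ]
        exact Ideal.mul_mem_mul hf₂ hg

omit hq in
open scoped Pointwise in
-- The r + 1 products a^i b^(r-i) of the two coordinates span.
theorem finrank_coordSpan_pow_le (P : RatPoint F q) (γ : F) (r : ℕ) :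
    FiniteDimensional F ↥(coordSpan P γ ^ r) ∧
      Module.finrank F ↥(coordSpan P γ ^ r) ≤ r + 1 := by
  classical
  set a : (HermitianRing F q)[X] := C (x F q) - algebraMap F _ P.1.1
  set b : (HermitianRing F q)[X] := X - algebraMap F _ γ
  let s : Finset (HermitianRing F q)[X] :=
    (Finset.range (r + 1)).image fun i => a ^ i * b ^ (r - i)
  have hs : coordSpan P γ ^ r ≤ Submodule.span F (s : Set (HermitianRing F q)[X]) := by
    rw [coordSpan, Submodule.span_pow]
    refine Submodule.span_mono ?_
    suffices h : ∀ r : ℕ, ∀ f ∈ ({a, b} : Set (HermitianRing F q)[X]) ^ r,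
        ∃ i j, i + j = r ∧ f = a ^ i * b ^ j by
      intro f hf
      obtain ⟨i, j, hij, rfl⟩ := h r f hf
      exact Finset.mem_coe.2 (Finset.mem_image.2 ⟨i, Finset.mem_range.2 (by omega), by
        rw [← hij, Nat.add_sub_cancel_left]⟩)
    intro r
    induction r with
    | zero =>
      intro f hf
      rw [pow_zero, Set.mem_one] at hf
      exact ⟨0, 0, rfl, by simp [hf]⟩
    | succ r ih =>
      intro f hf
      rw [pow_succ] at hf
      obtain ⟨g, hg, h, hh, rfl⟩ := Set.mem_mul.1 hf
      obtain ⟨i, j, hij, rfl⟩ := ih g hg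
      rcases hh with rfl | rfl
      · exact ⟨i + 1, j, by omega, by ring⟩
      · exact ⟨i, j + 1, by omega, by ring⟩
  have hfin : FiniteDimensional F ↥(Submodule.span F (s : Set (HermitianRing F q)[X])) :=
    FiniteDimensional.span_finset F s
  refine ⟨Submodule.finiteDimensional_of_le hs, (Submodule.finrank_mono hs).trans ?_⟩
  refine (finrank_span_finset_le_card s).trans (Finset.card_image_le.trans ?_)
  simp

/-- Adds up the layers of dimension at most 1, 2, ..., r. The sum need not be direct, as only an
upper bound on the codimension is wanted. -/
theorem exists_complement_maxIdeal_pow (hchar : (q : F) = 0) (P : RatPoint F q) (γ : F) (r : ℕ) :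
    ∃ W : Submodule F (HermitianRing F q)[X], FiniteDimensional F W ∧
      Module.finrank F W ≤ (r + 1).choose 2 ∧
      W ⊔ (maxIdeal P γ ^ r).restrictScalars F = ⊤ := by
  induction r with
  | zero => exact ⟨⊥, inferInstance, by simp, by simp⟩
  | succ r ih =>
    obtain ⟨W, hW, hle, htop⟩ := ih
    obtain ⟨hV, hVle⟩ := finrank_coordSpan_pow_le P γ r
    refine ⟨W ⊔ coordSpan P γ ^ r, inferInstance, ?_, ?_⟩
    · refine (Submodule.finrank_add_le_finrank_add_finrank _ _).trans ?_
      have := Nat.choose_succ_succ' (r + 1) 1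
      rw [Nat.choose_one_right] at this
      change _ ≤ (r + 1 + 1).choose (1 + 1)
      rw [this, add_comm (r + 1)]
      exact add_le_add hle hVle
    · rw [eq_top_iff, ← htop, sup_assoc]
      exact sup_le_sup_left (maxIdeal_pow_le hchar P γ r) _

theorem finrank_quotient_maxIdeal_pow_le (hchar : (q : F) = 0) (P : RatPoint F q) (γ : F)
    (r : ℕ) : FiniteDimensional F
        ((HermitianRing F q)[X] ⧸ (maxIdeal P γ ^ r).restrictScalars F) ∧
      Module.finrank F ((HermitianRing F q)[X] ⧸ (maxIdeal P γ ^ r).restrictScalars F) ≤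
        (r + 1).choose 2 := by
  obtain ⟨W, hW, hle, htop⟩ := exists_complement_maxIdeal_pow hchar P γ r
  let π : W →ₗ[F] (HermitianRing F q)[X] ⧸ (maxIdeal P γ ^ r).restrictScalars F :=
    (Submodule.mkQ _).comp W.subtype
  have hπ : Function.Surjective π := by
    intro g
    obtain ⟨f, rfl⟩ := Submodule.mkQ_surjective _ g
    obtain ⟨w, hw, m, hm, rfl⟩ := Submodule.mem_sup.1 (htop ▸ Submodule.mem_top :
      f ∈ W ⊔ (maxIdeal P γ ^ r).restrictScalars F)
    refine ⟨⟨w, hw⟩, ?_⟩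
    have hm0 : Submodule.mkQ ((maxIdeal P γ ^ r).restrictScalars F) m = 0 :=
      (Submodule.Quotient.mk_eq_zero _).2 hm
    rw [map_add, hm0, add_zero]
    rfl
  exact ⟨Module.Finite.of_surjective π hπ, (LinearMap.finrank_le_finrank_of_surjective hπ).trans hle⟩

theorem exists_combination_mem_interpIdeal [Fintype F] [DecidableEq F] (hchar : (q : F) = 0)
    (M : RatPoint F q → F → ℕ) (A : Finset (monomials F q))
    (hA : ∑ P : RatPoint F q, ∑ γ : F, (M P γ + 1).choose 2 < A.card) :
    ∃ c : monomials F q → F, ∑ φ ∈ A, c φ • (φ : (HermitianRing F q)[X]) ≠ 0 ∧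
      ∑ φ ∈ A, c φ • (φ : (HermitianRing F q)[X]) ∈ interpIdeal M := by
  classical
  let T : RatPoint F q × F → Type _ := fun p =>
    (HermitianRing F q)[X] ⧸ (maxIdeal p.1 p.2 ^ M p.1 p.2).restrictScalars F
  have hfin : ∀ p, FiniteDimensional F (T p) := fun p =>
    (finrank_quotient_maxIdeal_pow_le hchar p.1 p.2 _).1
  let L₁ : (A → F) →ₗ[F] (HermitianRing F q)[X] :=
    Fintype.linearCombination F (fun φ : A => (φ.1 : (HermitianRing F q)[X]))
  let L : (A → F) →ₗ[F] ∀ p, T p := (LinearMap.pi fun p => Submodule.mkQ _).comp L₁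
  have hlt : Module.finrank F (∀ p, T p) < Module.finrank F (A → F) := by
    rw [Module.finrank_pi_fintype, Module.finrank_fintype_fun_eq_card, Fintype.card_coe]
    refine lt_of_le_of_lt ?_ hA
    rw [← Fintype.sum_prod_type' (f := fun P γ => (M P γ + 1).choose 2)]
    exact Finset.sum_le_sum fun p _ => (finrank_quotient_maxIdeal_pow_le hchar p.1 p.2 _).2
  obtain ⟨c, hc, hc0⟩ := Submodule.exists_mem_ne_zero_of_ne_bot
    (LinearMap.ker_ne_bot_of_finrank_lt (f := L) hlt)
  have hsum : ∑ φ ∈ A, (if h : φ ∈ A then c ⟨φ, h⟩ else 0) • (φ : (HermitianRing F q)[X]) =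
      L₁ c := by
    rw [Fintype.linearCombination_apply, ← Finset.sum_coe_sort A]
    exact Finset.sum_congr rfl fun φ _ => by rw [dif_pos φ.2]
  refine ⟨fun φ => if h : φ ∈ A then c ⟨φ, h⟩ else 0, ?_, ?_⟩
  · rw [hsum]
    intro h0
    refine hc0 ?_
    have hli : LinearIndependent F (fun φ : A => (φ.1 : (HermitianRing F q)[X])) := by
      have := (monomialBasis F q).linearIndependent.comp (Subtype.val : A → _)
        Subtype.val_injective
      simpa [Function.comp_def] using this
    exact hli.fintypeLinearCombination_injective (h0.trans (map_zero L₁).symm)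
  · rw [hsum]
    intro P γ
    rw [le_mult_iff]
    have := congrFun (LinearMap.mem_ker.1 hc) (P, γ)
    exact (Submodule.Quotient.mk_eq_zero _).1 this

end Multiplicity
-- The monomial order, Q-polynomials and degree bounds
section Order

variable {F : Type*} [Field F] {q : ℕ} [hq : Fact (IsPrimePow q)]

theorem surfBasis_eq_monomial (m : (ℕ × Fin q) × ℕ) :
    surfBasis F q m = monomial m.2 (ringBasis F q m.1) := by
  rw [surfBasis_apply, ringBasis_apply, C_mul_X_pow_eq_monomial]

theorem natDegree_surfBasis (m : (ℕ × Fin q) × ℕ) : (surfBasis F q m).natDegree = m.2 := by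
  rw [surfBasis_eq_monomial, natDegree_monomial_eq _ ((ringBasis F q).ne_zero _)]

/-- The weighted degree of the monomial with the given exponents. -/
def expDeg (u : ℕ) (m : (ℕ × Fin q) × ℕ) : ℕ := weight m.1 + u * m.2

theorem degU_surfBasis (u : ℕ) (m : (ℕ × Fin q) × ℕ) :
    degU u (surfBasis F q m) = ((expDeg u m : ℤ) : WithBot ℤ) := by
  rw [degU, surfBasis_eq_monomial, support_monomial _ ((ringBasis F q).ne_zero _),
    Finset.sup_singleton, coeff_monomial_same, vInf_ringBasis, neg_neg, expDeg]
  push_cast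
  rfl

/-- The position of a monomial in the order `>_u`. -/
noncomputable def orderKey (u : ℕ) (φ : monomials F q) : ℕ ×ₗ ℕ :=
  toLex (expDeg u ((monomialEquiv F q).symm φ), ((monomialEquiv F q).symm φ).2)

theorem orderKey_injective (u : ℕ) : Function.Injective (orderKey (F := F) (q := q) u) := by
  intro φ ψ h
  obtain ⟨h1, h2⟩ := Prod.ext_iff.1 (toLex.injective h)
  refine (monomialEquiv F q).symm.injective (Prod.ext (weight_injective ?_) h2)
  simp only at h2
  simpa only [expDeg, h2, add_left_inj] using h1

theorem gtU_iff (u : ℕ) (φ ψ : monomials F q) :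
    GtU u (φ : (HermitianRing F q)[X]) ψ ↔ orderKey u ψ < orderKey u φ := by
  obtain ⟨m, rfl⟩ := (monomialEquiv F q).surjective φ
  obtain ⟨m', rfl⟩ := (monomialEquiv F q).surjective ψ
  rw [GtU, orderKey, orderKey, Prod.Lex.toLex_lt_toLex]
  simp only [coe_monomialEquiv, degU_surfBasis, natDegree_surfBasis, Equiv.symm_apply_apply,
    WithBot.coe_lt_coe, WithBot.coe_inj, Nat.cast_lt, Nat.cast_inj]

theorem isLeadingMonomial_iff (u : ℕ) (f : (HermitianRing F q)[X]) (φ : monomials F q) :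
    IsLeadingMonomial u f φ ↔ φ ∈ ((monomialBasis F q).repr f).support ∧
      ∀ ψ ∈ ((monomialBasis F q).repr f).support, orderKey u ψ ≤ orderKey u φ := by
  have hcoe : (fun ψ : monomials F q => (ψ : (HermitianRing F q)[X])) = monomialBasis F q :=
    funext fun ψ => (monomialBasis_apply F q ψ).symm
  rw [IsLeadingMonomial, hcoe]
  constructor
  · rintro ⟨c, rfl, hφ, hmax⟩
    rw [Module.Basis.repr_linearCombination]
    refine ⟨hφ, fun ψ hψ => ?_⟩
    rcases eq_or_ne ψ φ with rfl | h
    · exact le_rfl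
    · exact ((gtU_iff u φ ψ).1 (hmax ψ hψ h)).le
  · rintro ⟨hφ, hmax⟩
    refine ⟨_, (monomialBasis F q).linearCombination_repr f, hφ, fun ψ hψ h => ?_⟩
    exact (gtU_iff u φ ψ).2 (lt_of_le_of_ne (hmax ψ hψ) fun e => h (orderKey_injective u e))

theorem exists_isLeadingMonomial (u : ℕ) {f : (HermitianRing F q)[X]} (hf : f ≠ 0) :
    ∃ φ, IsLeadingMonomial u f φ := by
  have hne : ((monomialBasis F q).repr f).support.Nonempty := by
    rw [Finsupp.support_nonempty_iff]
    simpa using hf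
  obtain ⟨φ, hφ, hmax⟩ := Finset.exists_max_image _ (orderKey u) hne
  exact ⟨φ, (isLeadingMonomial_iff u f φ).2 ⟨hφ, hmax⟩⟩

theorem isQPolynomial_iff (u : ℕ) (M : RatPoint F q → F → ℕ) (Q : (HermitianRing F q)[X]) :
    IsQPolynomial u M Q ↔ Q ∈ interpIdeal M ∧ ∃ φ, IsLeadingMonomial u Q φ ∧
      ∀ f ∈ interpIdeal M, ∀ ψ, IsLeadingMonomial u f ψ → orderKey u φ ≤ orderKey u ψ := by
  rw [IsQPolynomial]
  have h (φ ψ : monomials F q) : (ψ = φ ∨ GtU u (ψ : (HermitianRing F q)[X]) φ) ↔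
      orderKey u φ ≤ orderKey u ψ := by
    rw [gtU_iff, le_iff_eq_or_lt, (orderKey_injective u).eq_iff, eq_comm]
  simp only [h]

theorem exists_isQPolynomial (u : ℕ) (M : RatPoint F q → F → ℕ)
    (hM : ∃ f ∈ interpIdeal M, f ≠ 0) : ∃ Q, IsQPolynomial u M Q := by
  let S : Set (ℕ ×ₗ ℕ) :=
    {k | ∃ f ∈ interpIdeal M, ∃ φ, IsLeadingMonomial u f φ ∧ orderKey u φ = k}
  have hS : S.Nonempty := by
    obtain ⟨f, hf, hf0⟩ := hM
    obtain ⟨φ, hφ⟩ := exists_isLeadingMonomial u hf0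
    exact ⟨_, f, hf, φ, hφ, rfl⟩
  obtain ⟨Q, hQ, φ, hφ, hk⟩ := wellFounded_lt.min_mem S hS
  refine ⟨Q, (isQPolynomial_iff u M Q).2 ⟨hQ, φ, hφ, fun f hf ψ hψ => ?_⟩⟩
  rw [hk]
  exact not_lt.1 (wellFounded_lt.not_lt_min S ⟨f, hf, ψ, hψ, rfl⟩)

/-- Both leading monomials coincide. Cancelling them leaves an element of I_M which, if nonzero,
would have a smaller leading monomial. -/
theorem IsQPolynomial.exists_eq_smul {u : ℕ} {M : RatPoint F q → F → ℕ}
    {Q Q' : (HermitianRing F q)[X]} (hQ : IsQPolynomial u M Q) (hQ' : IsQPolynomial u M Q') :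
    ∃ a : F, a ≠ 0 ∧ Q' = a • Q := by
  obtain ⟨hI, φ, hφ, hmin⟩ := (isQPolynomial_iff u M Q).1 hQ
  obtain ⟨hI', φ', hφ', hmin'⟩ := (isQPolynomial_iff u M Q').1 hQ'
  obtain rfl : φ = φ' :=
    orderKey_injective u (le_antisymm (hmin Q' hI' φ' hφ') (hmin' Q hI φ hφ))
  obtain ⟨hs, hmax⟩ := (isLeadingMonomial_iff u Q φ).1 hφ
  obtain ⟨hs', hmax'⟩ := (isLeadingMonomial_iff u Q' φ).1 hφ'
  set c := (monomialBasis F q).repr Q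
  set c' := (monomialBasis F q).repr Q'
  rw [Finsupp.mem_support_iff] at hs hs'
  refine ⟨c' φ / c φ, div_ne_zero hs' hs, ?_⟩
  by_contra hne
  have hD0 : Q' - (c' φ / c φ) • Q ≠ 0 := sub_ne_zero.2 hne
  have hDI : Q' - (c' φ / c φ) • Q ∈ interpIdeal M := by
    refine sub_mem hI' ?_
    rw [Algebra.smul_def]
    exact Ideal.mul_mem_left _ _ hI
  obtain ⟨ψ, hψ⟩ := exists_isLeadingMonomial u hD0
  have hle := hmin _ hDI ψ hψ
  have hψs := ((isLeadingMonomial_iff u _ ψ).1 hψ).1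
  have hrepr : (monomialBasis F q).repr (Q' - (c' φ / c φ) • Q) = c' - (c' φ / c φ) • c := by
    rw [map_sub, map_smul]
  rw [hrepr, Finsupp.mem_support_iff, Finsupp.sub_apply, Finsupp.smul_apply, smul_eq_mul] at hψs
  have hψφ : ψ ≠ φ := by
    rintro rfl
    exact hψs (by rw [div_mul_cancel₀ _ hs, sub_self])
  have hge : orderKey u ψ ≤ orderKey u φ := by
    by_cases h : c ψ = 0
    · refine hmax' ψ (Finsupp.mem_support_iff.2 ?_)
      rwa [h, mul_zero, sub_zero] at hψs
    · exact hmax ψ (Finsupp.mem_support_iff.2 h)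
  exact hψφ (orderKey_injective u (le_antisymm hge hle))

/-- Each qa is a non-gap, being the pole order of x^a, so the term j = 0 already gives C(qa) ≥ 1. -/
theorem exists_le_sum_countC (u N : ℕ) :
    ∃ w, N ≤ ∑ i ∈ Finset.range (w + 1), countC F q u i := by
  have hq0 : 0 < q := hq.out.pos
  refine ⟨q * N, ?_⟩
  have hsub : (Finset.range N).image (q * ·) ⊆ Finset.range (q * N + 1) := by
    intro i hi
    obtain ⟨a, ha, rfl⟩ := Finset.mem_image.1 hi
    rw [Finset.mem_range] at ha ⊢
    exact Nat.lt_succ_of_le (Nat.mul_le_mul_left _ ha.le)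
  have h1 : ∀ a, 1 ≤ countC F q u (q * a) := by
    intro a
    have hG : gapG F q (q * a) = 1 :=
      if_neg ((not_isGap_iff _).2 ⟨(a, ⟨0, hq0⟩), by simp [weight]⟩)
    rw [countC, Finset.sum_range_succ', mul_zero, Nat.sub_zero, hG]
    exact Nat.le_add_left _ _
  calc N = ∑ a ∈ Finset.range N, 1 := by simp
    _ ≤ ∑ a ∈ Finset.range N, countC F q u (q * a) := Finset.sum_le_sum fun a _ => h1 a
    _ = ∑ i ∈ (Finset.range N).image (q * ·), countC F q u i :=
        (Finset.sum_image fun a _ b _ h => Nat.eq_of_mul_eq_mul_left hq0 h).symm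
    _ ≤ _ := Finset.sum_le_sum_of_subset hsub

/-- A pair (i, j) with i - uj a non-gap yields a monomial of weighted degree i and z-degree j. -/
theorem exists_monomials_card_eq_sum_countC (u w : ℕ) :
    ∃ A : Finset (monomials F q), A.card = ∑ i ∈ Finset.range (w + 1), countC F q u i ∧
      ∀ φ ∈ A, expDeg u ((monomialEquiv F q).symm φ) ≤ w := by
  classical
  let T : Finset (Σ _ : ℕ, ℕ) := (Finset.range (w + 1)).sigma fun i =>
    (Finset.range (i / u + 1)).filter fun j => ¬ IsGap F q (i - u * j)
  have hT : T.card = ∑ i ∈ Finset.range (w + 1), countC F q u i := by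
    rw [Finset.card_sigma]
    refine Finset.sum_congr rfl fun i _ => ?_
    rw [countC, Finset.card_filter]
    refine Finset.sum_congr rfl fun j _ => ?_
    rw [gapG]
    split_ifs <;> simp_all
  have hex : ∀ p : Σ _ : ℕ, ℕ, ∃ m : (ℕ × Fin q) × ℕ,
      p ∈ T → m.2 = p.2 ∧ expDeg u m = p.1 := by
    rintro ⟨i, j⟩
    by_cases hp : (⟨i, j⟩ : Σ _ : ℕ, ℕ) ∈ T
    · obtain ⟨hi, hj⟩ := Finset.mem_sigma.1 hp
      obtain ⟨hj, hgap⟩ := Finset.mem_filter.1 hj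
      obtain ⟨m, hm⟩ := (not_isGap_iff _).1 hgap
      refine ⟨(m, j), fun _ => ⟨rfl, ?_⟩⟩
      -- Makes the truncated subtraction i - uj a true one.
      have hle : u * j ≤ i :=
        (Nat.mul_le_mul_left u (Nat.lt_succ_iff.1 (Finset.mem_range.1 hj))).trans
          (Nat.mul_div_le i u)
      simp only at hm
      simp only [expDeg, hm, Nat.sub_add_cancel hle]
    · exact ⟨((0, ⟨0, hq.out.pos⟩), 0), fun h => absurd h hp⟩
  choose g hg using hex
  refine ⟨T.image fun p => monomialEquiv F q (g p), ?_, ?_⟩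
  · rw [Finset.card_image_of_injOn, hT]
    intro p hp p' hp' h
    have h' := (monomialEquiv F q).injective h
    obtain ⟨h1, h2⟩ := hg p hp
    obtain ⟨h1', h2'⟩ := hg p' hp'
    rw [h'] at h1 h2
    exact Sigma.ext (h2.symm.trans h2') (heq_of_eq (h1.symm.trans h1'))
  · intro φ hφ
    obtain ⟨p, hp, rfl⟩ := Finset.mem_image.1 hφ
    rw [Equiv.symm_apply_apply, (hg p hp).2]
    exact Nat.lt_succ_iff.1 (Finset.mem_range.1 (Finset.mem_sigma.1 hp).1)

theorem degU_le_and_natDegree_le {u w : ℕ} (hu : 0 < u) {f : (HermitianRing F q)[X]} (hf : f ≠ 0)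
    (hle : ∀ m ∈ ((surfBasis F q).repr f).support, expDeg u m ≤ w) :
    degU u f ≤ ((w : ℤ) : WithBot ℤ) ∧ f.natDegree ≤ w / u := by
  have key : ∀ k ∈ f.support, ∃ m : ℕ × Fin q, expDeg u (m, k) ≤ w ∧
      vInf (algebraMap (HermitianRing F q) (HermitianField F q) (f.coeff k)) =
        -(weight m : ℤ) := by
    intro k hk
    obtain ⟨m, hm, -, hv⟩ := vInf_algebraMap (mem_support_iff.1 hk)
    refine ⟨m, hle (m, k) ?_, hv⟩
    rwa [Finsupp.mem_support_iff, surfBasis_repr_apply, ← Finsupp.mem_support_iff]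
  constructor
  · refine Finset.sup_le fun k hk => ?_
    obtain ⟨m, hm, hv⟩ := key k hk
    rw [hv, neg_neg, WithBot.coe_le_coe]
    exact_mod_cast hm
  · obtain ⟨m, hm, -⟩ := key _ (natDegree_mem_support_of_nonzero hf)
    rw [Nat.le_div_iff_mul_le hu, mul_comm]
    exact (Nat.le_add_left _ _).trans hm

/-- The combination supplied by (1) has its leading monomial in `A`, so that of Q, and with it every
monomial of Q, has weighted degree at most w. -/
theorem IsQPolynomial.degree_le [Fintype F] [DecidableEq F] (hchar : (q : F) = 0) {u w : ℕ}
    (hu : 0 < u) {M : RatPoint F q → F → ℕ} {Q : (HermitianRing F q)[X]}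
    (hQ : IsQPolynomial u M Q)
    (hw : 1 + (∑ P : RatPoint F q, ∑ γ : F, (M P γ + 1).choose 2) ≤
      ∑ i ∈ Finset.range (w + 1), countC F q u i) :
    degU u Q ≤ ((w : ℤ) : WithBot ℤ) ∧ Q.natDegree ≤ w / u := by
  obtain ⟨-, φ, hφ, hmin⟩ := (isQPolynomial_iff u M Q).1 hQ
  obtain ⟨A, hA, hAw⟩ := exists_monomials_card_eq_sum_countC (F := F) (q := q) u w
  obtain ⟨c, hc0, hcI⟩ := exists_combination_mem_interpIdeal hchar M A (by omega)
  obtain ⟨ψ, hψ⟩ := exists_isLeadingMonomial u hc0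
  have hψA : ψ ∈ A := by
    have h := ((isLeadingMonomial_iff u _ ψ).1 hψ).1
    rw [Finsupp.mem_support_iff] at h
    by_contra hψ
    refine h ?_
    simp only [← monomialBasis_apply, map_sum, map_smul, Module.Basis.repr_self,
      Finsupp.finsetSum_apply, Finsupp.smul_apply]
    refine Finset.sum_eq_zero fun χ hχ => ?_
    rw [Finsupp.single_eq_of_ne (by rintro rfl; exact hψ hχ), smul_zero]
  obtain ⟨hφs, hφmax⟩ := (isLeadingMonomial_iff u Q φ).1 hφ
  have hQ0 : Q ≠ 0 := by
    rintro rfl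
    simp at hφs
  refine degU_le_and_natDegree_le hu hQ0 fun m hm => ?_
  have hm' : monomialEquiv F q m ∈ ((monomialBasis F q).repr Q).support := by
    rw [Finsupp.mem_support_iff] at hm ⊢
    rwa [monomialBasis, Module.Basis.repr_reindex_apply, Equiv.symm_apply_apply]
  have hle := ((hφmax _ hm').trans (hmin _ hcI ψ hψ))
  have := Prod.Lex.monotone_fst_ofLex hle
  simp only [orderKey, ofLex_toLex, Equiv.symm_apply_apply] at this
  exact this.trans (hAw ψ hψA)

end Order
end Hermitian

theorem mainTheorem6 {F : Type*} [Field F] [Fintype F] [DecidableEq F] (q : ℕ)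
    [Fact (IsPrimePow q)] (hF : Fintype.card F = q ^ 2) (u : ℕ) (hu : 0 < u)
    (M : Hermitian.RatPoint F q → F → ℕ) :
    (∀ A : Finset (Hermitian.monomials F q),
      (∑ P : Hermitian.RatPoint F q, ∑ γ : F, (M P γ + 1).choose 2) < A.card →
      ∃ c : Hermitian.monomials F q → F,
        ∑ φ ∈ A, c φ • (φ : Polynomial (HermitianRing F q)) ≠ 0 ∧
        ∑ φ ∈ A, c φ • (φ : Polynomial (HermitianRing F q)) ∈ Hermitian.interpIdeal M) ∧
    (∃ Q : Polynomial (HermitianRing F q), Hermitian.IsQPolynomial u M Q) ∧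
    (∀ Q Q' : Polynomial (HermitianRing F q),
      Hermitian.IsQPolynomial u M Q → Hermitian.IsQPolynomial u M Q' →
      ∃ a : F, a ≠ 0 ∧ Q' = a • Q) ∧
    ∃ w : ℕ,
      IsLeast {v : ℕ | 1 + (∑ P : Hermitian.RatPoint F q, ∑ γ : F, (M P γ + 1).choose 2) ≤
        ∑ i ∈ Finset.range (v + 1), Hermitian.countC F q u i} w ∧
      ∀ Q : Polynomial (HermitianRing F q), Hermitian.IsQPolynomial u M Q →
        Hermitian.degU u Q ≤ ((w : ℤ) : WithBot ℤ) ∧ Q.natDegree ≤ w / u := by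
  have hchar : (q : F) = 0 := by
    have h := Nat.cast_card_eq_zero F
    rw [hF, Nat.cast_pow] at h
    exact pow_eq_zero_iff two_ne_zero |>.1 h
  have hinterp := Hermitian.exists_combination_mem_interpIdeal hchar M
  have hw := Hermitian.exists_le_sum_countC (F := F) (q := q) u
    (1 + ∑ P : Hermitian.RatPoint F q, ∑ γ : F, (M P γ + 1).choose 2)
  refine ⟨hinterp, Hermitian.exists_isQPolynomial u M ?_, fun Q Q' hQ hQ' => hQ.exists_eq_smul hQ',
    sInf _, ⟨Nat.sInf_mem hw, fun _ => Nat.sInf_le⟩,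
    fun Q hQ => hQ.degree_le hchar hu (Nat.sInf_mem hw)⟩
  -- What remains is a nonzero element of I_M, without which no Q-polynomial exists.
  obtain ⟨w, hw⟩ := hw
  obtain ⟨A, hA, -⟩ := Hermitian.exists_monomials_card_eq_sum_countC (F := F) (q := q) u w
  obtain ⟨c, hc0, hcI⟩ := hinterp A (by omega)
  exact ⟨_, hcI, hc0⟩
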